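/- Let $(M^{2m+1},H,J,\theta)$ be a (non-empty) pseudo-Hermitian manifold, that is: $M$ is a smooth manifold of dimension $2m+1$, $\theta$ is a nowhere vanishing smooth real $1$-form, $H=\ker\theta$, $J$ is a smooth complex structure on $H$ whose space $T_{1,0}M=\{a-\sqrt{-1}Ja : a\in H\}$ of $(1,0)$-vectors satisfies $[\Gamma(T_{1,0}M),\Gamma(T_{1,0}M)]\subseteq\Gamma(T_{1,0}M)$, and the Levi form $L_\theta(X,Y)=d\theta(X,JY)$ is positive definite on $H$, where $2d\theta(X,Y)=X\theta(Y)-Y\theta(X)-\theta([X,Y])$. Let $\xi$ be the Reeb field ($\theta(\xi)=1$, $d\theta(\xi,\cdot)=0$), extend $J$ by $J\xi=0$, let $\pi_H:TM\to H$ be the projection along $\xi$, and let $g_\theta=L_\theta(\pi_H\cdot,\pi_H\cdot)+\theta\otimes\theta$ be the Webster metric, with norm $|\cdot|$ (and $|X|^2=g_\theta(X,\overline X)$ for complex $X$). Let $\nabla u$ denote the $g_\theta$-gradient of a function $u$ and $\nabla^Hu=\pi_H\nabla u$. Let $\nabla$ also denote the Tanaka–Webster connection, i.e. the unique linear connection that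 preserves $H$, satisfies $\nabla J=0$ and $\nabla g_\theta=0$, and has torsion $T$ with $T(X,Y)=2d\theta(X,Y)\xi$ and $T(\xi,JX)+JT(\xi,X)=0$ for $X,Y\in H$. Put $(\nabla du)(Y,Z)=Y(Zu)-(\nabla_YZ)u$, extended complex bilinearly, and $\Delta_bu=\mathrm{trace}_H(\nabla du)$, the trace being taken with respect to $L_\theta$. Let $G$ be a smooth function on $[0,+\infty)$ with (i) $G(0)>0$; (ii) $G'\ge 0$; (iii) $G^{-1/2}\notin L^1(+\infty)$; (iv) $\limsup_{t\to+\infty}\frac{t\,G(t^{1/2})}{G(t)}<+\infty$, let $A,B>0$ be constants, and let $\gamma$ be a non-negative $C^2$ function on $M$ such that for every $\eta>0$ there is a compact set $K_\eta\subset M$ with $\gamma>\eta$ outside $K_\eta$. (a) Assume that, outside some compact subset of $M$, $$|\nabla^H\gamma|\le A\gamma^{1/2}\quad (1)\qquad\text{and}\qquad \Delta_b\gamma\le B\gamma^{1/2}G(\gamma^{1/2})^{1/2}\quad (2).$$ Then for every $C^2$ function $u:M\to\mathbb R$ bounded from above there is a sequence $\{x_k\}\subset M$ such that $$\lim_{k\to\infty}u(x_k)=\sup_Mu,\qquad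 \lim_{k\to\infty}|\nabla^Hu(x_k)|=0,\qquad \limsup_{k\to\infty}\Delta_bu(x_k)\le 0.$$ (b) If (1) is replaced by the assumption that $|\nabla\gamma|\le A\gamma^{1/2}$ outside some compact subset of $M$, then the second conclusion can be strengthened to $\lim_{k\to\infty}|\nabla u(x_k)|=0$. (c) If (2) is replaced by the assumption that, outside some compact subset of $M$, $\mathrm{Re}\,\nabla d\gamma(X,\overline X)\le B\gamma^{1/2}G(\gamma^{1/2})^{1/2}|X|^2$ for every $X\in T_{1,0}M$, then the third conclusion can be strengthened to $$\limsup_{k\to\infty}\mathrm{Re}\,\nabla du(Y_k,\overline{Y_k})\le 0\quad\text{for every choice of } Y_k\in T_{1,0}M_{x_k}\text{ with }|Y_k|=1.$$ (d) If both replacements are made, then there is a sequence with both strengthened conclusions. -/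

import Mathlib

open Set Filter Topology Bundle MeasureTheory
open scoped Manifold ContDiff

noncomputable section

namespace CR

/-- The model space `ℝ^(2m+1)` of a CR manifold of CR dimension `m`. -/
abbrev Model (m : ℕ) : Type := EuclideanSpace ℝ (Fin (2 * m + 1))

section

variable {m : ℕ} {M : Type*} [TopologicalSpace M] [ChartedSpace (Model m) M]

/-- Tangent vectors at `x`. -/
abbrev Tan (m : ℕ) {M : Type*} [TopologicalSpace M] [ChartedSpace (Model m) M] (x : M) : Type :=
  TangentSpace 𝓘(ℝ, Model m) x

/-- The vector field `X` is smooth near the point `x`. -/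
def SmoothFieldAt [IsManifold 𝓘(ℝ, Model m) ∞ M] (X : Π x : M, Tan m x) (x : M) : Prop :=
  ContMDiffAt 𝓘(ℝ, Model m) 𝓘(ℝ, Model m).tangent ∞
    (fun y ↦ (⟨y, X y⟩ : TangentBundle 𝓘(ℝ, Model m) M)) x

/-- The vector field `X` is differentiable at the point `x`. -/
abbrev DiffFieldAt [IsManifold 𝓘(ℝ, Model m) ∞ M] (X : Π x : M, Tan m x) (x : M) : Prop :=
  MDifferentiableAt 𝓘(ℝ, Model m) 𝓘(ℝ, Model m).tangent
    (fun y ↦ (TotalSpace.mk' (Model m) y (X y) : TangentBundle 𝓘(ℝ, Model m) M)) x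

/-! ### Complex tangent vectors

The pair `(a, b)` of real tangent vectors stands for the complex tangent vector `a + i b` of
`T_xM ⊗ ℂ`. -/

/-- Complex tangent vectors `a + i b` at `x`. -/
abbrev CTan (m : ℕ) {M : Type*} [TopologicalSpace M] [ChartedSpace (Model m) M] (x : M) : Type :=
  Tan m x × Tan m x

/-- Complex conjugation `a + i b ↦ a - i b`. -/
def conjC {x : M} (Z : CTan m x) : CTan m x := (Z.1, -Z.2)

/-- The complex bilinear extension of a real bilinear form on the tangent space. -/
def extendC {x : M} (b : Tan m x → Tan m x → ℝ) (Z W : CTan m x) : ℂ :=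
  ⟨b Z.1 W.1 - b Z.2 W.2, b Z.1 W.2 + b Z.2 W.1⟩

/-- The Lie bracket of real vector fields. -/
def lie (X Y : Π x : M, Tan m x) : Π x : M, Tan m x :=
  VectorField.mlieBracket 𝓘(ℝ, Model m) X Y

/-- The complex bilinear extension of the Lie bracket to complex vector fields. -/
def lieC (Z W : Π x : M, CTan m x) (x : M) : CTan m x :=
  (lie (fun y ↦ (Z y).1) (fun y ↦ (W y).1) x - lie (fun y ↦ (Z y).2) (fun y ↦ (W y).2) x,
    lie (fun y ↦ (Z y).1) (fun y ↦ (W y).2) x + lie (fun y ↦ (Z y).2) (fun y ↦ (W y).1) x)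

lemma mvfderiv_congr {F : Type*} [NormedAddCommGroup F] [NormedSpace ℝ F] {f g : M → F} {x : M}
    (h : f =ᶠ[𝓝 x] g) :
    mvfderiv 𝓘(ℝ, Model m) f x = mvfderiv 𝓘(ℝ, Model m) g x := by
  ext v
  exact congrArg (fun L : Model m →L[ℝ] F ↦ L v) h.mfderiv_eq

/-! ### One-forms and their exterior derivative -/

variable [IsManifold 𝓘(ℝ, Model m) ∞ M]

/-- A smooth real one-form on `M`. -/
structure OneForm (m : ℕ) (M : Type*) [TopologicalSpace M] [ChartedSpace (Model m) M]
    [IsManifold 𝓘(ℝ, Model m) ∞ M] where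
  toFun : Π x : M, Tan m x →L[ℝ] ℝ
  smooth : ContMDiff 𝓘(ℝ, Model m) (𝓘(ℝ, Model m).prod 𝓘(ℝ, Model m →L[ℝ] ℝ)) ∞
    (fun x ↦ (⟨x, toFun x⟩ :
      TotalSpace (Model m →L[ℝ] ℝ) (fun x : M ↦ Tan m x →L[ℝ] Trivial M ℝ x)))

instance : CoeFun (OneForm m M) (fun _ ↦ Π x : M, Tan m x →L[ℝ] ℝ) := ⟨OneForm.toFun⟩

namespace OneForm

lemma smoothAt_apply (θ : OneForm m M) {X : Π x : M, Tan m x} {x : M}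
    (hX : SmoothFieldAt X x) :
    ContMDiffAt 𝓘(ℝ, Model m) 𝓘(ℝ, ℝ) ∞ (fun y ↦ θ y (X y)) x := by
  have := ContMDiffAt.clm_bundle_apply (E₂ := Trivial M ℝ) (θ.smooth x) hX
  rw [contMDiffAt_section] at this
  exact this

lemma mdifferentiableAt_apply (θ : OneForm m M) {X : Π x : M, Tan m x} {x : M}
    (hX : DiffFieldAt X x) :
    MDifferentiableAt 𝓘(ℝ, Model m) 𝓘(ℝ, ℝ) (fun y ↦ θ y (X y)) x := by
  have := MDifferentiableAt.clm_bundle_apply (E₂ := Trivial M ℝ)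
    ((θ.smooth x).mdifferentiableAt (by simp)) hX
  rw [mdifferentiableAt_section] at this
  exact this

/-- `2 dθ(X, Y) = X (θ Y) - Y (θ X) - θ [X, Y]`, for vector fields. -/
def dAux (θ : OneForm m M) (X Y : Π x : M, Tan m x) (x : M) : ℝ :=
  (1 / 2) * (mvfderiv 𝓘(ℝ, Model m) (fun y ↦ θ y (Y y)) x (X x)
    - mvfderiv 𝓘(ℝ, Model m) (fun y ↦ θ y (X y)) x (Y x) - θ x (lie X Y x))

lemma dAux_swap (θ : OneForm m M) (X Y : Π x : M, Tan m x) (x : M) :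
    dAux θ X Y x = - dAux θ Y X x := by
  simp only [dAux, lie]
  rw [VectorField.mlieBracket_swap_apply, map_neg]
  ring

lemma dAux_tensorial₁ (θ : OneForm m M) (x : M) (Y : Π x : M, Tan m x) :
    TensorialAt 𝓘(ℝ, Model m) (Model m) (fun X ↦ dAux θ X Y x) x where
  smul {f X} hf hX := by
    have h1 := mvfderiv_fun_mul hf (θ.mdifferentiableAt_apply hX)
    simp only [dAux, lie, VectorField.mlieBracket_smul_left hf hX, Pi.smul_apply', map_smul,
      smul_eq_mul, map_add, h1]
    simp
    ring
  add {X X'} hX hX' := by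
    have h1 := mvfderiv_fun_add (θ.mdifferentiableAt_apply hX) (θ.mdifferentiableAt_apply hX')
    simp only [dAux, lie, VectorField.mlieBracket_add_left hX hX', Pi.add_apply, map_add, h1]
    simp
    ring

lemma dAux_tensorial₂ (θ : OneForm m M) (x : M) (X : Π x : M, Tan m x) :
    TensorialAt 𝓘(ℝ, Model m) (Model m) (fun Y ↦ dAux θ X Y x) x where
  smul {f Y} hf hY := by
    have := (dAux_tensorial₁ θ x X).smul hf hY
    rw [dAux_swap θ X, dAux_swap θ X, this, smul_neg]
  add {Y Y'} hY hY' := by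
    have := (dAux_tensorial₁ θ x X).add hY hY'
    rw [dAux_swap θ X, dAux_swap θ X, dAux_swap θ X, this]
    ring

/-- The exterior derivative `dθ`, normalized so that
`2 dθ(X, Y) = X (θ Y) - Y (θ X) - θ [X, Y]`. -/
def d (θ : OneForm m M) (x : M) : Tan m x →L[ℝ] Tan m x →L[ℝ] ℝ :=
  TensorialAt.mkHom₂ (fun X Y ↦ dAux θ X Y x) x
    (fun Y _ ↦ dAux_tensorial₁ θ x Y) (fun X _ ↦ dAux_tensorial₂ θ x X)

lemma d_apply (θ : OneForm m M) {x : M} {X Y : Π x : M, Tan m x}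
    (hX : DiffFieldAt X x) (hY : DiffFieldAt Y x) :
    θ.d x (X x) (Y x) = (1 / 2) * (mvfderiv 𝓘(ℝ, Model m) (fun y ↦ θ y (Y y)) x (X x)
      - mvfderiv 𝓘(ℝ, Model m) (fun y ↦ θ y (X y)) x (Y x) - θ x (lie X Y x)) :=
  TensorialAt.mkHom₂_apply (fun Y _ ↦ dAux_tensorial₁ θ x Y) (fun X _ ↦ dAux_tensorial₂ θ x X)
    hX hY

lemma d_swap (θ : OneForm m M) {x : M} (v w : Tan m x) : θ.d x v w = - θ.d x w v :=
  dAux_swap θ _ _ x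

lemma d_self (θ : OneForm m M) {x : M} (v : Tan m x) : θ.d x v v = 0 := by
  have := θ.d_swap v v
  linarith

end OneForm

/-- A smooth `(1, 1)`-tensor field on `M`. -/
structure EndField (m : ℕ) (M : Type*) [TopologicalSpace M] [ChartedSpace (Model m) M]
    [IsManifold 𝓘(ℝ, Model m) ∞ M] where
  toFun : Π x : M, Tan m x →L[ℝ] Tan m x
  smooth : ContMDiff 𝓘(ℝ, Model m) (𝓘(ℝ, Model m).prod 𝓘(ℝ, Model m →L[ℝ] Model m)) ∞
    (fun x ↦ (⟨x, toFun x⟩ :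
      TotalSpace (Model m →L[ℝ] Model m) (fun x : M ↦ Tan m x →L[ℝ] Tan m x)))

instance : CoeFun (EndField m M) (fun _ ↦ Π x : M, Tan m x →L[ℝ] Tan m x) := ⟨EndField.toFun⟩

lemma EndField.smoothAt_apply (J : EndField m M) {X : Π x : M, Tan m x} {x : M}
    (hX : SmoothFieldAt X x) : SmoothFieldAt (fun y ↦ J y (X y)) x :=
  ContMDiffAt.clm_bundle_apply (J.smooth x) hX

/-- The space `T_{1,0}` of type `(1, 0)` vectors at `x` attached to `H = ker θ` and to a complex
structure `J` on `H`: the vectors `a - i J a` with `a ∈ H`, i.e. the `i`-eigenspace of `J` on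
`H ⊗ ℂ`. -/
def typeOneZero (θ : OneForm m M) (J : EndField m M) (x : M) : Set (CTan m x) :=
  {Z | θ x Z.1 = 0 ∧ Z.2 = - J x Z.1}

end

/-- A pseudo-Hermitian manifold `(M, H, J, θ)` of CR dimension `m`: a nowhere vanishing one-form
`θ` with `H = ker θ`, and a complex structure `J` on `H`, extended to `TM` by zero on the kernel
of `dθ` (the Reeb direction), such that `T_{1,0}` is closed under the Lie bracket of (local)
sections and the Levi form `dθ(v, J v)` is positive definite on `H`. -/
structure PseudoHermitian (m : ℕ) (M : Type*) [TopologicalSpace M] [ChartedSpace (Model m) M]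
    [IsManifold 𝓘(ℝ, Model m) ∞ M] where
  /-- The pseudo-Hermitian structure. -/
  θ : OneForm m M
  θ_ne_zero : ∀ x, θ x ≠ 0
  /-- The complex structure on `H = ker θ`, extended by zero on the Reeb direction. -/
  J : EndField m M
  J_mem : ∀ x v, θ x v = 0 → θ x (J x v) = 0
  J_J : ∀ x v, θ x v = 0 → J x (J x v) = -v
  J_reeb : ∀ x v, (∀ w, θ.d x v w = 0) → J x v = 0
  integrable : ∀ (x : M) (Z W : Π y : M, CTan m y),
    SmoothFieldAt (fun y ↦ (Z y).1) x → SmoothFieldAt (fun y ↦ (Z y).2) x →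
    SmoothFieldAt (fun y ↦ (W y).1) x → SmoothFieldAt (fun y ↦ (W y).2) x →
    (∀ᶠ y in 𝓝 x, Z y ∈ typeOneZero θ J y) → (∀ᶠ y in 𝓝 x, W y ∈ typeOneZero θ J y) →
    lieC Z W x ∈ typeOneZero θ J x
  levi_pos : ∀ x v, θ x v = 0 → v ≠ 0 → 0 < θ.d x v (J x v)

namespace PseudoHermitian

variable {m : ℕ} {M : Type*} [TopologicalSpace M] [ChartedSpace (Model m) M]
  [IsManifold 𝓘(ℝ, Model m) ∞ M] (P : PseudoHermitian m M)

/-- The Levi distribution `H = ker θ`. -/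
def H (x : M) : Submodule ℝ (Tan m x) := LinearMap.ker (P.θ x).toLinearMap

lemma mem_H {x : M} {v : Tan m x} : v ∈ P.H x ↔ P.θ x v = 0 := Iff.rfl

/-- The space of type `(1, 0)` vectors at `x`. -/
def T10 (x : M) : Set (CTan m x) := typeOneZero P.θ P.J x

/-- The Levi form `L_θ(v, w) = dθ(v, J w)`. -/
def levi (x : M) (v w : Tan m x) : ℝ := P.θ.d x v (P.J x w)

lemma exists_eq_one (x : M) : ∃ t : Tan m x, P.θ x t = 1 := by
  obtain ⟨t, ht⟩ : ∃ t, P.θ x t ≠ 0 := by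
    by_contra! h
    exact P.θ_ne_zero x (ContinuousLinearMap.ext h)
  exact ⟨(P.θ x t)⁻¹ • t, by simp [ht]⟩

lemma exists_field {x : M} {v : Tan m x} (hv : v ∈ P.H x) :
    ∃ X : Π y : M, Tan m y, SmoothFieldAt X x ∧ (∀ y, P.θ y (X y) = 0) ∧ X x = v := by
  obtain ⟨t, ht⟩ := P.exists_eq_one x
  have hV : SmoothFieldAt (FiberBundle.extend (Model m) v) x :=
    FiberBundle.contMDiffAt_extend _ _ v
  have hT : SmoothFieldAt (FiberBundle.extend (Model m) t) x :=
    FiberBundle.contMDiffAt_extend _ _ t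
  refine ⟨fun y ↦ P.θ y (FiberBundle.extend (Model m) t y) • FiberBundle.extend (Model m) v y
    - P.θ y (FiberBundle.extend (Model m) v y) • FiberBundle.extend (Model m) t y,
    ?_, fun y ↦ ?_, ?_⟩
  · exact ContMDiffAt.sub_section ((P.θ.smoothAt_apply hT).smul_section hV)
      ((P.θ.smoothAt_apply hV).smul_section hT)
  · simp [mul_comm]
  · simp [ht, P.mem_H.1 hv]

lemma d_J_J {x : M} {v w : Tan m x} (hv : v ∈ P.H x) (hw : w ∈ P.H x) :
    P.θ.d x (P.J x v) (P.J x w) = P.θ.d x v w := by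
  obtain ⟨X, hX, hX0, rfl⟩ := P.exists_field hv
  obtain ⟨Y, hY, hY0, rfl⟩ := P.exists_field hw
  have hX' : SmoothFieldAt (fun y ↦ -P.J y (X y)) x := (P.J.smoothAt_apply hX).neg_section
  have hY' : SmoothFieldAt (fun y ↦ -P.J y (Y y)) x := (P.J.smoothAt_apply hY).neg_section
  have key := (P.integrable x (fun y ↦ (X y, -P.J y (X y))) (fun y ↦ (Y y, -P.J y (Y y)))
    hX hX' hY hY' (.of_forall fun y ↦ ⟨hX0 y, rfl⟩) (.of_forall fun y ↦ ⟨hY0 y, rfl⟩)).1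
  have hX0' : ∀ y, P.θ y (-P.J y (X y)) = 0 := fun y ↦ by simp [P.J_mem y _ (hX0 y)]
  have hY0' : ∀ y, P.θ y (-P.J y (Y y)) = 0 := fun y ↦ by simp [P.J_mem y _ (hY0 y)]
  have h1 := P.θ.d_apply (hX.mdifferentiableAt (by simp)) (hY.mdifferentiableAt (by simp))
  have h2 := P.θ.d_apply (hX'.mdifferentiableAt (by simp)) (hY'.mdifferentiableAt (by simp))
  simp only [hX0, hY0, hX0', hY0', mvfderiv_const] at h1 h2
  simp only [lieC, map_sub] at key
  simp only [map_neg, neg_apply, neg_neg] at h2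
  rw [h1, h2]
  simp
  linarith

lemma levi_symm {x : M} {v w : Tan m x} (hv : v ∈ P.H x) (hw : w ∈ P.H x) :
    P.levi x v w = P.levi x w v := by
  have h := P.d_J_J hv (P.J_mem x w hw)
  rw [P.J_J x w hw, map_neg, ← P.θ.d_swap] at h
  exact h.symm

instance (x : M) : FiniteDimensional ℝ (Tan m x) :=
  inferInstanceAs (FiniteDimensional ℝ (Model m))

/-- A bilinear form `b` on the tangent space without a vector `v ≠ 0` such that `b v = 0`
represents every linear form. -/
lemma exists_represent {M : Type*} [TopologicalSpace M] [ChartedSpace (Model m) M] {x : M}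
    (b : LinearMap.BilinForm ℝ (Tan m x))
    (hb : ∀ v, b v = 0 → v = 0) (ℓ : Tan m x →L[ℝ] ℝ) : ∃ w, ∀ v, b w v = ℓ v := by
  have hinj : Function.Injective b := (injective_iff_map_eq_zero b).2 hb
  have hsurj := (LinearMap.injective_iff_surjective_of_finrank_eq_finrank
    (Subspace.dual_finrank_eq (K := ℝ) (V := Tan m x)).symm).1 hinj
  obtain ⟨w, hw⟩ := hsurj ℓ.toLinearMap
  exact ⟨w, fun v ↦ by rw [hw]; rfl⟩

/-- Existence of the Reeb vector at each point. -/
lemma exists_reeb (x : M) : ∃ ξ : Tan m x, P.θ x ξ = 1 ∧ ∀ w, P.θ.d x ξ w = 0 := by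
  let b : LinearMap.BilinForm ℝ (Tan m x) :=
    LinearMap.mk₂ ℝ (fun v w ↦ P.θ.d x v w + P.θ x v * P.θ x w)
      (fun v v' w ↦ by simp; ring) (fun c v w ↦ by simp; ring)
      (fun v w w' ↦ by simp; ring) (fun c v w ↦ by simp; ring)
  have hbv : ∀ v w, b v w = P.θ.d x v w + P.θ x v * P.θ x w := fun _ _ ↦ rfl
  have hb : ∀ v, b v = 0 → v = 0 := by
    intro v hv
    have h1 : b v v = 0 := by rw [hv]; rfl
    rw [hbv, P.θ.d_self, zero_add, mul_self_eq_zero] at h1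
    by_contra hne
    have h2 : b v (P.J x v) = 0 := by rw [hv]; rfl
    rw [hbv, h1, zero_mul, add_zero] at h2
    exact (P.levi_pos x v h1 hne).ne' h2
  obtain ⟨ξ, hξ⟩ := exists_represent b hb (P.θ x)
  have h1 : P.θ x ξ * P.θ x ξ = P.θ x ξ := by
    have := hξ ξ
    rwa [hbv, P.θ.d_self, zero_add] at this
  have hξ1 : P.θ x ξ = 1 := by
    by_contra hne
    have h0 : P.θ x ξ = 0 := by
      by_contra h0
      exact hne (mul_left_cancel₀ h0 (by rw [h1, mul_one]))
    have h2 : ξ = 0 := by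
      by_contra hξ0
      have := hξ (P.J x ξ)
      rw [hbv, h0, zero_mul, add_zero, P.J_mem x ξ h0] at this
      exact (P.levi_pos x ξ h0 hξ0).ne' this
    apply P.θ_ne_zero x
    ext v
    rw [← hξ v, h2]
    simp
  refine ⟨ξ, hξ1, fun w ↦ ?_⟩
  have := hξ w
  rw [hbv, hξ1, one_mul] at this
  linarith

/-- The Reeb vector field `ξ`: `θ(ξ) = 1` and `dθ(ξ, ·) = 0`. -/
def reeb (x : M) : Tan m x := (P.exists_reeb x).choose

lemma θ_reeb (x : M) : P.θ x (P.reeb x) = 1 := (P.exists_reeb x).choose_spec.1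

lemma d_reeb (x : M) (w : Tan m x) : P.θ.d x (P.reeb x) w = 0 := (P.exists_reeb x).choose_spec.2 w

/-- The projection `π_H : TM → H` along the Reeb field. -/
def projH (x : M) : Tan m x →ₗ[ℝ] Tan m x :=
  LinearMap.id - (P.θ x).toLinearMap.smulRight (P.reeb x)

lemma projH_apply {x : M} (v : Tan m x) : P.projH x v = v - P.θ x v • P.reeb x := rfl

lemma projH_mem {x : M} (v : Tan m x) : P.projH x v ∈ P.H x := by
  simp [mem_H, projH_apply, θ_reeb]

/-- The Webster metric `g_θ(v, w) = L_θ(π_H v, π_H w) + θ(v) θ(w)`. -/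
def webster (x : M) : LinearMap.BilinForm ℝ (Tan m x) :=
  LinearMap.mk₂ ℝ (fun v w ↦ P.levi x (P.projH x v) (P.projH x w) + P.θ x v * P.θ x w)
    (fun v v' w ↦ by simp [levi]; ring) (fun c v w ↦ by simp [levi]; ring)
    (fun v w w' ↦ by simp [levi]; ring) (fun c v w ↦ by simp [levi]; ring)

lemma webster_apply {x : M} (v w : Tan m x) :
    P.webster x v w = P.levi x (P.projH x v) (P.projH x w) + P.θ x v * P.θ x w := rfl

lemma webster_pos {x : M} {v : Tan m x} (hv : v ≠ 0) : 0 < P.webster x v v := by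
  rw [webster_apply]
  by_cases h : P.projH x v = 0
  · have h' : P.θ x v ≠ 0 := by
      intro h0
      rw [projH_apply, h0] at h
      simp at h
      exact hv h
    rw [h]
    simp only [levi, map_zero, zero_add]
    exact mul_self_pos.2 h'
  · have := P.levi_pos x _ (P.projH_mem v) h
    have h2 := mul_self_nonneg (P.θ x v)
    unfold levi
    linarith

/-- The norm `|v|` of a real tangent vector with respect to the Webster metric. -/
def norm {x : M} (v : Tan m x) : ℝ := √(P.webster x v v)

/-- The norm `|Z|` of a complex tangent vector, `|Z|² = g_θ(Z, conj Z)`. -/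
def normC {x : M} (Z : CTan m x) : ℝ :=
  √(extendC (fun v w ↦ P.webster x v w) Z (conjC Z)).re

/-! ### Gradients -/

lemma exists_gradient (x : M) (ℓ : Tan m x →L[ℝ] ℝ) :
    ∃ w : Tan m x, ∀ v, P.webster x w v = ℓ v := by
  refine exists_represent _ (fun v hv ↦ ?_) ℓ
  by_contra hne
  exact (P.webster_pos hne).ne' (by rw [hv]; rfl)

/-- The gradient `∇u` with respect to the Webster metric. -/
def grad (u : M → ℝ) (x : M) : Tan m x :=
  (P.exists_gradient x (mvfderiv 𝓘(ℝ, Model m) u x)).choose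

lemma webster_grad (u : M → ℝ) (x : M) (v : Tan m x) :
    P.webster x (P.grad u x) v = mvfderiv 𝓘(ℝ, Model m) u x v :=
  (P.exists_gradient x (mvfderiv 𝓘(ℝ, Model m) u x)).choose_spec v

/-- The horizontal gradient `∇^H u = π_H ∇u`. -/
def gradH (u : M → ℝ) (x : M) : Tan m x := P.projH x (P.grad u x)

/-! ### The Tanaka-Webster connection -/

/-- The defining properties of the Tanaka-Webster connection `∇`. Here `D Y x v` is
`∇_v Y` at the point `x`. -/
structure IsTanakaWebster
    (D : CovariantDerivative 𝓘(ℝ, Model m) (Model m)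
      (TangentSpace 𝓘(ℝ, Model m) : M → Type _)) : Prop where
  /-- `∇` preserves sections of `H`. -/
  horizontal : ∀ (x : M) (Y : Π y : M, Tan m y), SmoothFieldAt Y x →
    (∀ᶠ y in 𝓝 x, Y y ∈ P.H y) → ∀ v, D Y x v ∈ P.H x
  /-- `∇J = 0`. -/
  parallel_J : ∀ (x : M) (Y : Π y : M, Tan m y), SmoothFieldAt Y x →
    ∀ v, D (fun y ↦ P.J y (Y y)) x v = P.J x (D Y x v)
  /-- `∇g_θ = 0`. -/
  parallel_g : ∀ (x : M) (Y Z : Π y : M, Tan m y), SmoothFieldAt Y x → SmoothFieldAt Z x →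
    ∀ v, mvfderiv 𝓘(ℝ, Model m) (fun y ↦ P.webster y (Y y) (Z y)) x v
      = P.webster x (D Y x v) (Z x) + P.webster x (Y x) (D Z x v)
  /-- The torsion is pure: `T(v, w) = 2 dθ(v, w) ξ` for horizontal `v`, `w`. -/
  torsion_H : ∀ (x : M), ∀ v ∈ P.H x, ∀ w ∈ P.H x,
    D.torsion x v w = (2 * P.θ.d x v w) • P.reeb x
  /-- The torsion is pure: `T(ξ, J v) + J T(ξ, v) = 0` for horizontal `v`. -/
  torsion_reeb : ∀ (x : M), ∀ v ∈ P.H x,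
    D.torsion x (P.reeb x) (P.J x v) + P.J x (D.torsion x (P.reeb x) v) = 0

/-- Some covariant derivative on `M` (differentiation in the preferred chart at each point). -/
instance : Nonempty (CovariantDerivative 𝓘(ℝ, Model m) (Model m)
    (TangentSpace 𝓘(ℝ, Model m) : M → Type _)) := by
  let t (x : M) := trivializationAt (Model m) (TangentSpace 𝓘(ℝ, Model m) : M → Type _) x
  have hmem (x : M) : ∀ᶠ y in 𝓝 x, y ∈ (t x).baseSet :=
    (t x).open_baseSet.mem_nhds (FiberBundle.mem_baseSet_trivializationAt' x)
  have hdiff (σ : Π y : M, Tan m y) (x : M) (hσ : DiffFieldAt σ x) :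
      MDifferentiableAt 𝓘(ℝ, Model m) 𝓘(ℝ, Model m) (fun y ↦ (t x ⟨y, σ y⟩).2) x :=
    (mdifferentiableAt_section ..).1 hσ
  refine ⟨⟨fun σ x ↦ ((t x).symmL ℝ x).comp
    (mvfderiv 𝓘(ℝ, Model m) (fun y ↦ (t x ⟨y, σ y⟩).2) x), ?_, ?_⟩⟩
  · intro σ σ' x hσ hσ' _
    have h : (fun y ↦ (t x ⟨y, (σ + σ') y⟩).2)
        =ᶠ[𝓝 x] fun y ↦ (t x ⟨y, σ y⟩).2 + (t x ⟨y, σ' y⟩).2 := by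
      filter_upwards [hmem x] with y hy
      exact ((t x).linear ℝ hy).map_add _ _
    have h2 := mvfderiv_fun_add (hdiff σ x hσ) (hdiff σ' x hσ')
    rw [← mvfderiv_congr h] at h2
    rw [h2, ContinuousLinearMap.comp_add]
  · intro σ g x hσ hg _
    have h : (fun y ↦ (t x ⟨y, (g • σ) y⟩).2)
        =ᶠ[𝓝 x] fun y ↦ g y • (t x ⟨y, σ y⟩).2 := by
      filter_upwards [hmem x] with y hy
      exact ((t x).linear ℝ hy).map_smul _ _
    have h2 := mvfderiv_fun_smul hg (hdiff σ x hσ)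
    rw [← mvfderiv_congr h] at h2
    rw [h2]
    ext v
    simp only [ContinuousLinearMap.comp_add, ContinuousLinearMap.comp_smul, add_apply,
      ContinuousLinearMap.comp_apply, ContinuousLinearMap.smulRight_apply, map_smul]
    congr 2
    rw [Trivialization.symmL_apply]
    · exact (t x).symm_apply_apply_mk (FiberBundle.mem_baseSet_trivializationAt' x) (σ x)
    · exact FiberBundle.mem_baseSet_trivializationAt' x

/-- The Tanaka-Webster connection: the (unique) connection with the defining properties. -/
def tanakaWebster : CovariantDerivative 𝓘(ℝ, Model m) (Model m)
    (TangentSpace 𝓘(ℝ, Model m) : M → Type _) :=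
  Classical.epsilon P.IsTanakaWebster

/-! ### Hessian and sub-Laplacian -/

/-- `(∇du)(Y, Z) = Y (Z u) - (∇_Y Z) u` for vector fields `Y`, `Z`. -/
def hessField (u : M → ℝ) (Y Z : Π y : M, Tan m y) (x : M) : ℝ :=
  mvfderiv 𝓘(ℝ, Model m) (fun y ↦ mvfderiv 𝓘(ℝ, Model m) u y (Z y)) x (Y x)
    - mvfderiv 𝓘(ℝ, Model m) u x (P.tanakaWebster Z x (Y x))

/-- The Hessian `(∇du)(v, w)` with respect to the Tanaka-Webster connection, computed by
extending the tangent vectors `v`, `w` to vector fields that are smooth near `x`. -/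
def hess (u : M → ℝ) (x : M) (v w : Tan m x) : ℝ :=
  P.hessField u (FiberBundle.extend (Model m) v) (FiberBundle.extend (Model m) w) x

lemma mdifferentiableAt_mvfderiv_apply {u : M → ℝ} {x : M}
    (hu : ContMDiffAt 𝓘(ℝ, Model m) 𝓘(ℝ, ℝ) 2 u x) {Z : Π y : M, Tan m y}
    (hZ : DiffFieldAt Z x) :
    MDifferentiableAt 𝓘(ℝ, Model m) 𝓘(ℝ, ℝ)
      (fun y ↦ mvfderiv 𝓘(ℝ, Model m) u y (Z y)) x := by
  have h : ContMDiffAt 𝓘(ℝ, Model m) (𝓘(ℝ, Model m).prod 𝓘(ℝ, Model m →L[ℝ] ℝ)) 1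
      (fun x ↦ (⟨x, mvfderiv 𝓘(ℝ, Model m) u x⟩ :
      TotalSpace (Model m →L[ℝ] ℝ) (fun x : M ↦ Tan m x →L[ℝ] Trivial M ℝ x))) x := by
    rw [contMDiffAt_hom_bundle]
    refine ⟨contMDiffAt_id, ?_⟩
    have := hu.mfderiv_const (m := 1) (by norm_num)
    convert this using 1
    ext y v
    simp only [inTangentCoordinates, ContinuousLinearMap.inCoordinates]
    rw [TangentBundle.continuousLinearMapAt_model_space]
    simp
    rfl
  have := MDifferentiableAt.clm_bundle_apply (E₂ := Trivial M ℝ)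
    (h.mdifferentiableAt (by simp)) hZ
  rw [mdifferentiableAt_section] at this
  exact this

/-- The Hessian of a `C²` function does not depend on the extension to vector fields. -/
lemma hess_eq_hessField {u : M → ℝ} {x : M} (hu : ContMDiffAt 𝓘(ℝ, Model m) 𝓘(ℝ, ℝ) 2 u x)
    {Y Z : Π y : M, Tan m y} (hZ : DiffFieldAt Z x) :
    P.hess u x (Y x) (Z x) = P.hessField u Y Z x := by
  have h : TensorialAt 𝓘(ℝ, Model m) (Model m) (fun Z ↦ P.hessField u Y Z x) x :=
    { smul := fun {f Z} hf hZ ↦ by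
        have h1 := mvfderiv_fun_mul hf (mdifferentiableAt_mvfderiv_apply hu hZ)
        have h2 := P.tanakaWebster.isCovariantDerivativeOn.leibniz hZ hf (s := univ)
        simp only [hessField, Pi.smul_apply', map_smul, smul_eq_mul, h1, h2]
        simp
        ring
      add := fun {Z Z'} hZ hZ' ↦ by
        have h1 := mvfderiv_fun_add (mdifferentiableAt_mvfderiv_apply hu hZ)
          (mdifferentiableAt_mvfderiv_apply hu hZ')
        have h2 := P.tanakaWebster.isCovariantDerivativeOn.add hZ hZ' (s := univ)
        simp only [hessField, Pi.add_apply, map_add, h1, h2]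
        simp
        ring }
  rw [← h.pointwise (FiberBundle.mdifferentiableAt_extend _ _ (Z x)) hZ (by simp)]
  simp [hess, hessField]

/-- `Re ∇du(Z, conj Z)` for a complex tangent vector `Z`. -/
def reHess (u : M → ℝ) (x : M) (Z : CTan m x) : ℝ :=
  (extendC (P.hess u x) Z (conjC Z)).re

lemma exists_frame (x : M) : ∃ e : Fin (2 * m) → Tan m x,
    (∀ i, e i ∈ P.H x) ∧ ∀ i j, P.levi x (e i) (e j) = if i = j then 1 else 0 := by
  let core : InnerProductSpace.Core ℝ (P.H x) :=
    { inner := fun v w ↦ P.levi x v w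
      conj_inner_symm := fun v w ↦ by simpa using P.levi_symm w.2 v.2
      re_inner_nonneg := fun v ↦ by
        by_cases h : (v : Tan m x) = 0
        · simp [h, levi]
        · exact (P.levi_pos x v v.2 h).le
      add_left := fun v v' w ↦ by simp [levi]
      smul_left := fun v w c ↦ by simp [levi]
      definite := fun v hv ↦ by
        by_contra h
        exact (P.levi_pos x v v.2 (by simpa using h)).ne' hv }
  let _ : NormedAddCommGroup (P.H x) := core.toNormedAddCommGroup
  let _ : InnerProductSpace ℝ (P.H x) := InnerProductSpace.ofCore core.toCore
  have hdim : Module.finrank ℝ (P.H x) = 2 * m := by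
    have h := Module.Dual.finrank_ker_add_one_of_ne_zero (f := (P.θ x).toLinearMap)
      (fun h ↦ P.θ_ne_zero x (ContinuousLinearMap.coe_injective h))
    have h2 : Module.finrank ℝ (Tan m x) = 2 * m + 1 := finrank_euclideanSpace_fin
    rw [h2] at h
    exact Nat.succ_injective h
  let e := (stdOrthonormalBasis ℝ (P.H x)).reindex (finCongr hdim)
  exact ⟨fun i ↦ e i, fun i ↦ (e i).2, fun i j ↦ orthonormal_iff_ite.1 e.orthonormal i j⟩

/-- An `L_θ`-orthonormal basis of `H_x`. -/
def frame (x : M) : Fin (2 * m) → Tan m x := (P.exists_frame x).choose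

lemma frame_mem (x : M) (i : Fin (2 * m)) : P.frame x i ∈ P.H x :=
  (P.exists_frame x).choose_spec.1 i

lemma levi_frame (x : M) (i j : Fin (2 * m)) :
    P.levi x (P.frame x i) (P.frame x j) = if i = j then 1 else 0 :=
  (P.exists_frame x).choose_spec.2 i j

/-- The sub-Laplacian `Δ_b u = trace_H (∇du)`. -/
def subLaplacian (u : M → ℝ) (x : M) : ℝ :=
  ∑ i, P.hess u x (P.frame x i) (P.frame x i)

end PseudoHermitian

end CR

end

/-! Let ψ be the primitive of `G ^ (-1/2)` vanishing at `0`. Since `G` is positive and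
nondecreasing, ψ is increasing and concave, and the non-integrability (iii) says that ψ tends to
infinity. Hence `u - ψ(γ)/(k+1)` attains its maximum at some `x k`, and `u (x k)` tends to the
supremum of `u`.

Concavity avoids differentiating ψ(γ): ψ lies below its tangent at `γ (x k)`, so `x k` also
maximizes `u - c k * γ`, where `c k` is the slope of that tangent divided by `k+1`
(`exists_seq_isMaxOn_sub_mul`). At such a point `du = c k * dγ`. The connection terms of the two
Hessians are then proportional and cancel, leaving the Hessian of `u` at most `c k` times that of
`γ` on the diagonal (`hess_le_of_touching`). Traces and the forms `Re ∇du(X, conj X)` are sums of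
diagonal values, so they inherit the inequality.

Condition (iv) bounds `G(γ) ^ (-1/2) * √γ * √(G √γ)` by a constant for large `γ`
(`exists_sqrt_mul_sqrt_le`), so every hypothesis on `γ`, multiplied by `c k`, becomes O(1/(k+1)).
The hypotheses hold only off a compact set. If `u` has no maximum, the `x k` eventually leave each
compact set; if it has one, the constant sequence with `c k = 0` works. -/

/-- The second derivative of a real function is nonpositive at a local maximum. -/
lemma IsLocalMax.deriv_deriv_nonpos {f : ℝ → ℝ} {a : ℝ} (h : IsLocalMax f a)
    (hf : ContinuousAt f a) : deriv (deriv f) a ≤ 0 := by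
  by_contra! hpos
  have hmin := isLocalMin_of_deriv_deriv_pos hpos h.deriv_eq_zero hf
  -- A positive second derivative would make the critical point a local minimum as well, so `f`
  -- would be locally constant.
  have hconst : f =ᶠ[𝓝 a] fun _ ↦ f a := by
    filter_upwards [h, hmin] with t h1 h2 using le_antisymm h1 h2
  rw [hconst.deriv.deriv_eq] at hpos
  simp at hpos

/-! ### The weight, its concave primitive, and the growth condition. -/

/-- The weight `G ^ (-1/2)`, extended to the negative half-line by its value at `0`. -/
noncomputable def invSqrtWeight (G : ℝ → ℝ) (t : ℝ) : ℝ := G (max t 0) ^ (-(1 / 2) : ℝ)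

section invSqrtWeight

variable {G : ℝ → ℝ} (hc : ContinuousOn G (Ici 0)) (hmono : MonotoneOn G (Ici 0)) (h0 : 0 < G 0)

include hmono h0 in
lemma pos_of_monotoneOn {t : ℝ} (ht : 0 ≤ t) : 0 < G t :=
  h0.trans_le (hmono self_mem_Ici ht ht)

include hmono h0 in
lemma invSqrtWeight_pos (t : ℝ) : 0 < invSqrtWeight G t :=
  Real.rpow_pos_of_pos (pos_of_monotoneOn hmono h0 (le_max_right _ _)) _

include hmono h0 in
lemma antitone_invSqrtWeight : Antitone (invSqrtWeight G) := fun s t hst ↦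
  Real.rpow_le_rpow_of_nonpos (pos_of_monotoneOn hmono h0 (le_max_right _ _))
    (hmono (le_max_right s 0) (le_max_right t 0) (max_le_max_right 0 hst)) (by norm_num)

include hc hmono h0 in
lemma continuous_invSqrtWeight : Continuous (invSqrtWeight G) := by
  have h : Continuous fun t : ℝ ↦ G (max t 0) :=
    hc.comp_continuous (by fun_prop) fun t ↦ le_max_right t 0
  exact h.rpow_const fun t ↦ .inl (pos_of_monotoneOn hmono h0 (le_max_right _ _)).ne'

include hmono h0 in
lemma invSqrtWeight_mul_sqrt {t : ℝ} (ht : 0 ≤ t) : invSqrtWeight G t * √(G t) = 1 := by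
  have hp := pos_of_monotoneOn hmono h0 ht
  rw [invSqrtWeight, max_eq_left ht, Real.sqrt_eq_rpow, ← Real.rpow_add hp]
  simp

include hc hmono h0 in
/-- The primitive of the nonincreasing weight lies below its tangents. -/
lemma integral_invSqrtWeight_sub_le (s t : ℝ) :
    (∫ r in (0 : ℝ)..s, invSqrtWeight G r) - ∫ r in (0 : ℝ)..t, invSqrtWeight G r
      ≤ invSqrtWeight G t * (s - t) := by
  have hcont := continuous_invSqrtWeight hc hmono h0
  have hanti := antitone_invSqrtWeight hmono h0
  rw [intervalIntegral.integral_interval_sub_left (hcont.intervalIntegrable _ _)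
    (hcont.intervalIntegrable _ _)]
  rcases le_total t s with hts | hst
  · have := intervalIntegral.integral_mono_on hts (hcont.intervalIntegrable t s)
      (intervalIntegrable_const (c := invSqrtWeight G t) (μ := volume)) fun r hr ↦ hanti hr.1
    simpa [mul_comm] using this
  · have := intervalIntegral.integral_mono_on hst
      (intervalIntegrable_const (c := invSqrtWeight G t) (μ := volume))
      (hcont.intervalIntegrable s t) fun r hr ↦ hanti hr.2
    rw [intervalIntegral.integral_symm]
    simp at this
    linarith

-- A monotone primitive either diverges or has a finite limit; since the weight is positive, a
-- finite limit would make it integrable on the half-line, contrary to (iii).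
include hc hmono h0 in
lemma tendsto_integral_invSqrtWeight
    (hint : ¬ IntegrableAtFilter (fun t : ℝ ↦ G t ^ (-(1 / 2) : ℝ)) atTop volume) :
    Tendsto (fun t ↦ ∫ r in (0 : ℝ)..t, invSqrtWeight G r) atTop atTop := by
  have hcont := continuous_invSqrtWeight hc hmono h0
  have hpos := invSqrtWeight_pos hmono h0
  have hm : Monotone fun t ↦ ∫ r in (0 : ℝ)..t, invSqrtWeight G r := fun s t hst ↦ by
    have := integral_invSqrtWeight_sub_le hc hmono h0 s t
    have := mul_nonneg (hpos t).le (sub_nonneg.2 hst)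
    linarith
  rcases tendsto_atTop_of_monotone hm with h | ⟨l, h⟩
  · exact h
  · refine absurd ⟨Ioi 0, Ioi_mem_atTop 0, ?_⟩ hint
    have hI : IntegrableOn (invSqrtWeight G) (Ioi 0) volume :=
      integrableOn_Ioi_of_intervalIntegral_norm_tendsto (b := id) (l := atTop) l 0
        (fun i ↦ hcont.integrableOn_Ioc) tendsto_id
        (by simpa [Real.norm_of_nonneg (hpos _).le] using h)
    refine hI.congr_fun (fun t ht ↦ ?_) measurableSet_Ioi
    simp [invSqrtWeight, max_eq_left (mem_Ioi.1 ht).le]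

include hmono h0 in
/-- The growth condition on `G` bounds `√t √(G (√t))` by a multiple of `√(G t)`. -/
lemma exists_sqrt_mul_sqrt_le
    (hlim : limsup (fun t : ℝ ↦ ((t * G (√t) / G t : ℝ) : EReal)) atTop < ⊤) :
    ∃ D T : ℝ, 0 ≤ D ∧ 0 < T ∧ ∀ t, T < t →
      invSqrtWeight G t * (√t * √(G (√t))) ≤ D ∧ invSqrtWeight G t * √t ≤ D := by
  obtain ⟨C, hC, -⟩ := EReal.lt_iff_exists_real_btwn.1 hlim
  obtain ⟨T, hT⟩ := eventually_atTop.1 (eventually_lt_of_limsup_lt hC)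
  -- The first entry of the maximum comes from the square root of `t * G √t ≤ |C| * G t`, the second
  -- from dividing that bound by `√(G 0) ≤ √(G √t)`. The `1` only keeps the threshold positive.
  refine ⟨max √|C| (√|C| / √(G 0)), max T 1, by positivity, by positivity, fun t ht ↦ ?_⟩
  have ht0 : 0 < t := one_pos.trans ((le_max_right T 1).trans_lt ht)
  have hGt := pos_of_monotoneOn hmono h0 ht0.le
  have hw := (invSqrtWeight_pos hmono h0 t).le
  have h1 : t * G √t ≤ |C| * G t := by
    have := hT t ((le_max_left T 1).trans ht.le)
    rw [EReal.coe_lt_coe_iff, div_lt_iff₀ hGt] at this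
    exact this.le.trans (mul_le_mul_of_nonneg_right (le_abs_self C) hGt.le)
  have h2 : invSqrtWeight G t * (√t * √(G √t)) ≤ √|C| := by
    have := Real.sqrt_le_sqrt h1
    rw [Real.sqrt_mul ht0.le, Real.sqrt_mul (abs_nonneg C)] at this
    calc _ ≤ invSqrtWeight G t * (√|C| * √(G t)) := mul_le_mul_of_nonneg_left this hw
      _ = √|C| * (invSqrtWeight G t * √(G t)) := by ring
      _ = √|C| := by rw [invSqrtWeight_mul_sqrt hmono h0 ht0.le, mul_one]
  refine ⟨h2.trans (le_max_left _ _), le_trans ?_ (le_max_right _ _)⟩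
  rw [le_div_iff₀ (Real.sqrt_pos.2 h0), mul_assoc]
  refine le_trans ?_ h2
  gcongr
  exact hmono self_mem_Ici (Real.sqrt_nonneg t) (Real.sqrt_nonneg t)

/-! ### The maximizing sequence. -/

include hc hmono h0 in
/-- The comparison step of the Omori–Yau maximum principle: a continuous function bounded from
above has a maximizing sequence at whose points it is touched from above by small multiples of an
exhaustion function. -/
theorem exists_seq_isMaxOn_sub_mul {M : Type*} [TopologicalSpace M] [Nonempty M]
    {γ : M → ℝ} (hγ : Continuous γ) (hγ_nonneg : ∀ x, 0 ≤ γ x)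
    (hγ_proper : ∀ η : ℝ, 0 < η → ∃ K : Set M, IsCompact K ∧ ∀ x ∉ K, η < γ x)
    (hint : ¬ IntegrableAtFilter (fun t : ℝ ↦ G t ^ (-(1 / 2) : ℝ)) atTop volume)
    (hlim : limsup (fun t : ℝ ↦ ((t * G (√t) / G t : ℝ) : EReal)) atTop < ⊤)
    {u : M → ℝ} (hu : Continuous u) (hbdd : BddAbove (range u))
    {p : M → Prop} (hp : ∃ K, IsCompact K ∧ ∀ x ∉ K, p x) :
    ∃ (x : ℕ → M) (c : ℕ → ℝ) (D : ℝ), Tendsto (fun k ↦ u (x k)) atTop (𝓝 (⨆ y, u y)) ∧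
      (∀ k, 0 ≤ c k) ∧ (∀ k y, u y - c k * γ y ≤ u (x k) - c k * γ (x k)) ∧
      ∀ᶠ k in atTop, (c k = 0 ∨ p (x k)) ∧
        c k * (√(γ (x k)) * √(G (√(γ (x k))))) ≤ D / (k + 1) ∧
        c k * √(γ (x k)) ≤ D / (k + 1) := by
  -- A maximum point may lie inside the compact set where nothing is known about `p`; there `c = 0`
  -- makes all estimates trivial. This is why the conclusion offers `c k = 0` as an alternative to
  -- `p (x k)`.
  by_cases hatt : ∃ x₀, ∀ y, u y ≤ u x₀
  · obtain ⟨x₀, hx₀⟩ := hatt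
    have hsup : ⨆ y, u y = u x₀ := le_antisymm (ciSup_le hx₀) (le_ciSup hbdd x₀)
    exact ⟨fun _ ↦ x₀, fun _ ↦ 0, 0, by simp [hsup], by simp, by simpa using hx₀, by simp⟩
  push Not at hatt
  obtain ⟨D, T, hD, hT, hDT⟩ := exists_sqrt_mul_sqrt_le hmono h0 hlim
  obtain ⟨K₁, hK₁, hpK₁⟩ := hp
  obtain ⟨K₂, hK₂, hγK₂⟩ := hγ_proper T hT
  have hcont := continuous_invSqrtWeight hc hmono h0
  have hpos := invSqrtWeight_pos hmono h0
  set ψ : ℝ → ℝ := fun t ↦ ∫ r in (0 : ℝ)..t, invSqrtWeight G r with hψ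
  have hψc : Continuous ψ := intervalIntegral.continuous_primitive hcont.intervalIntegrable 0
  have hψ_nonneg : ∀ x, 0 ≤ ψ (γ x) := fun x ↦
    intervalIntegral.integral_nonneg (hγ_nonneg x) fun r _ ↦ (hpos r).le
  have hψ_top : Tendsto ψ atTop atTop := tendsto_integral_invSqrtWeight hc hmono h0 hint
  have hψ_tangent : ∀ s t, ψ s - ψ t ≤ invSqrtWeight G t * (s - t) :=
    integral_invSqrtWeight_sub_le hc hmono h0
  obtain ⟨b, hb⟩ := hbdd
  have hb' : ∀ y, u y ≤ b := fun y ↦ hb ⟨y, rfl⟩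
  have hmax : ∀ k : ℕ, ∃ x, ∀ y, u y - ψ (γ y) / (k + 1) ≤ u x - ψ (γ x) / (k + 1) := by
    intro k
    have hcts : Continuous fun y ↦ u y - ψ (γ y) / (k + 1) := by fun_prop
    obtain ⟨x₁⟩ := ‹Nonempty M›
    have hk : (0 : ℝ) < k + 1 := by positivity
    refine hcts.exists_forall_ge' x₁ ?_
    -- Coercivity: as `u ≤ b`, the penalized function falls below its value at `x₁` once ψ(γ)
    -- exceeds `k+1` times the gap between `b` and that value.
    obtain ⟨η, hη⟩ := eventually_atTop.1
      (hψ_top.eventually_ge_atTop ((k + 1) * (b - (u x₁ - ψ (γ x₁) / (k + 1)))))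
    obtain ⟨K, hK, hγK⟩ := hγ_proper (max η 1) (by positivity)
    filter_upwards [hK.compl_mem_cocompact] with y hy
    have h1 := hη (γ y) ((le_max_left η 1).trans (hγK y hy).le)
    rw [← le_div_iff₀' hk] at h1
    have h2 := hb' y
    linarith
  choose x hx using hmax
  have htend : Tendsto (fun k ↦ u (x k)) atTop (𝓝 (⨆ y, u y)) := by
    refine tendsto_order.2 ⟨fun a ha ↦ ?_, fun a ha ↦ .of_forall fun k ↦
      (le_ciSup ⟨b, hb⟩ (x k)).trans_lt ha⟩
    -- Compare with a fixed competitor `y` nearly realizing the supremum: its penalty vanishes as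
    -- `k` grows, while the penalty at `x k` is nonnegative and can be dropped.
    obtain ⟨y, hy⟩ := exists_lt_of_lt_ciSup ha
    have hlim0 : Tendsto (fun k : ℕ ↦ u y - ψ (γ y) / (k + 1)) atTop (𝓝 (u y - 0)) :=
      tendsto_const_nhds.sub
        (tendsto_const_nhds.div_atTop (tendsto_natCast_atTop_atTop.atTop_add tendsto_const_nhds))
    filter_upwards [hlim0.eventually_const_lt (by simpa using hy)] with k hk
    have h1 := hx k y
    have h2 : 0 ≤ ψ (γ (x k)) / (k + 1) := div_nonneg (hψ_nonneg _) (by positivity)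
    linarith
  refine ⟨x, fun k ↦ invSqrtWeight G (γ (x k)) / (k + 1), D, htend,
    fun k ↦ div_nonneg (hpos _).le (by positivity), fun k y ↦ ?_, ?_⟩
  -- The tangent inequality at `γ (x k)` turns maximality for the penalty ψ(γ) into maximality for a
  -- linear penalty.
  · have h1 := hx k y
    have h2 : (ψ (γ y) - ψ (γ (x k))) / (k + 1)
        ≤ invSqrtWeight G (γ (x k)) * (γ y - γ (x k)) / (k + 1) := by
      gcongr
      exact hψ_tangent _ _
    have h3 : invSqrtWeight G (γ (x k)) * (γ y - γ (x k)) / (k + 1)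
      = invSqrtWeight G (γ (x k)) / (k + 1) * γ y
        - invSqrtWeight G (γ (x k)) / (k + 1) * γ (x k) := by ring
    rw [sub_div] at h2
    linarith
  -- The maximum of `u` over a compact set is strictly below its unattained supremum, so `u (x k)`
  -- eventually exceeds it.
  · have hout : ∀ᶠ k in atTop, x k ∉ K₁ ∪ K₂ := by
      rcases (K₁ ∪ K₂).eq_empty_or_nonempty with he | hne
      · simp [he]
      obtain ⟨z, -, hz⟩ := (hK₁.union hK₂).exists_isMaxOn hne hu.continuousOn
      obtain ⟨y, hy⟩ := hatt z
      filter_upwards [htend.eventually_const_lt (hy.trans_le (le_ciSup ⟨b, hb⟩ y))] with k hk hmem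
      exact hk.not_ge (hz hmem)
    filter_upwards [hout] with k hk
    simp only [mem_union, not_or] at hk
    obtain ⟨h1, h2⟩ := hDT _ (hγK₂ _ hk.2)
    refine ⟨.inr (hpK₁ _ hk.1), ?_, ?_⟩ <;>
    · rw [div_mul_eq_mul_div]
      gcongr

end invSqrtWeight

/-! ### First and second order conditions at a maximum on the manifold. -/

namespace CR

section

variable {m : ℕ} {M : Type*} [TopologicalSpace M] [ChartedSpace (Model m) M]

/-- The chain rule along a curve. -/
lemma hasDerivAt_comp_curve {w : M → ℝ} {c : ℝ → M} {t : ℝ} {v : Tan m (c t)}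
    (hw : MDifferentiableAt 𝓘(ℝ, Model m) 𝓘(ℝ, ℝ) w (c t))
    (hc : HasMFDerivAt 𝓘(ℝ, ℝ) 𝓘(ℝ, Model m) c t ((1 : ℝ →L[ℝ] ℝ).smulRight v)) :
    HasDerivAt (fun s ↦ w (c s)) (mvfderiv 𝓘(ℝ, Model m) w (c t) v) t := by
  have h : HasFDerivAt (w ∘ c) ((mvfderiv 𝓘(ℝ, Model m) w (c t)).comp
      ((1 : ℝ →L[ℝ] ℝ).smulRight (v : Model m))) t := (hw.hasMFDerivAt.comp t hc).hasFDerivAt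
  have h2 := h.hasDerivAt
  have h3 : ((mvfderiv 𝓘(ℝ, Model m) w (c t)).comp
      ((1 : ℝ →L[ℝ] ℝ).smulRight (v : Model m))) 1 = mvfderiv 𝓘(ℝ, Model m) w (c t) v :=
    congrArg (mvfderiv 𝓘(ℝ, Model m) w (c t)) (one_smul ℝ (v : Model m))
  rwa [h3] at h2

lemma mvfderiv_sub_mul {u γ : M → ℝ} {x : M} (c : ℝ)
    (hu : MDifferentiableAt 𝓘(ℝ, Model m) 𝓘(ℝ, ℝ) u x)
    (hγ : MDifferentiableAt 𝓘(ℝ, Model m) 𝓘(ℝ, ℝ) γ x) (v : Tan m x) :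
    mvfderiv 𝓘(ℝ, Model m) (fun y ↦ u y - c * γ y) x v
      = mvfderiv 𝓘(ℝ, Model m) u x v - c * mvfderiv 𝓘(ℝ, Model m) γ x v := by
  have hc : MDifferentiableAt 𝓘(ℝ, Model m) 𝓘(ℝ, ℝ) (fun _ : M ↦ c) x := mdifferentiableAt_const
  have h1 := mvfderiv_fun_mul hc hγ
  have h2 := mvfderiv_fun_sub (g' := fun y ↦ c * γ y) hu (hc.mul hγ)
  simp only [mvfderiv_const] at h1
  simpa [h1] using congrArg (fun L : Tan m x →L[ℝ] ℝ ↦ L v) h2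

variable [IsManifold 𝓘(ℝ, Model m) ∞ M]

/-- Restricting to an integral curve of a local extension of `v` reduces this to one variable. -/
lemma mvfderiv_eq_zero_of_isLocalMax {w : M → ℝ} {x : M} (hmax : IsLocalMax w x)
    (hw : MDifferentiableAt 𝓘(ℝ, Model m) 𝓘(ℝ, ℝ) w x) (v : Tan m x) :
    mvfderiv 𝓘(ℝ, Model m) w x v = 0 := by
  obtain ⟨c, rfl, hc⟩ := exists_isMIntegralCurveAt_of_contMDiffAt_boundaryless
    (I := 𝓘(ℝ, Model m)) (t₀ := 0)
    ((FiberBundle.contMDiffAt_extend 𝓘(ℝ, Model m) (Model m) v).of_le (m := 1) le_top)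
  have h0 := hasDerivAt_comp_curve hw hc.self_of_nhds
  rw [FiberBundle.extend_apply_self] at h0
  have hlm : IsLocalMax (fun s ↦ w (c s)) 0 :=
    hc.self_of_nhds.continuousAt.eventually hmax
  exact hlm.hasDerivAt_eq_zero h0

/-- At a local maximum, second derivatives along a vector field are nonpositive. -/
lemma mvfderiv_mvfderiv_nonpos_of_isLocalMax {w : M → ℝ} {x : M} (hmax : IsLocalMax w x)
    (hw : ContMDiffAt 𝓘(ℝ, Model m) 𝓘(ℝ, ℝ) 2 w x) {X : Π y : M, Tan m y}
    (hX : SmoothFieldAt X x) :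
    mvfderiv 𝓘(ℝ, Model m) (fun y ↦ mvfderiv 𝓘(ℝ, Model m) w y (X y)) x (X x) ≤ 0 := by
  obtain ⟨c, rfl, hc⟩ := exists_isMIntegralCurveAt_of_contMDiffAt_boundaryless
    (I := 𝓘(ℝ, Model m)) (t₀ := 0) (hX.of_le (m := 1) (by simp))
  have hcont := hc.self_of_nhds.continuousAt
  have hw' : ∀ᶠ y in 𝓝 (c 0), MDifferentiableAt 𝓘(ℝ, Model m) 𝓘(ℝ, ℝ) w y := by
    filter_upwards [(contMDiffAt_iff_contMDiffAt_nhds (by simp)).1 hw] with y hy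
    exact hy.mdifferentiableAt (by simp)
  -- The first derivative must be identified on a whole neighbourhood of `0`, since it is
  -- differentiated once more.
  have hderiv : deriv (fun s ↦ w (c s))
      =ᶠ[𝓝 0] fun s ↦ mvfderiv 𝓘(ℝ, Model m) w (c s) (X (c s)) := by
    filter_upwards [hc, hcont.eventually hw'] with t ht hwt
    exact (hasDerivAt_comp_curve hwt ht).deriv
  have h2 := hasDerivAt_comp_curve
    (PseudoHermitian.mdifferentiableAt_mvfderiv_apply hw (hX.mdifferentiableAt (by simp)))
    hc.self_of_nhds
  rw [← h2.deriv, ← hderiv.deriv_eq]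
  have hlm : IsLocalMax (fun s ↦ w (c s)) 0 := hcont.eventually hmax
  exact hlm.deriv_deriv_nonpos (hw.continuousAt.comp hcont)

/-- Where `u - c γ` is maximal, `du = c dγ`. -/
lemma mvfderiv_eq_of_touching {u γ : M → ℝ} {x : M} {c : ℝ}
    (hu : ContMDiff 𝓘(ℝ, Model m) 𝓘(ℝ, ℝ) 2 u) (hγ : ContMDiff 𝓘(ℝ, Model m) 𝓘(ℝ, ℝ) 2 γ)
    (hmax : ∀ y, u y - c * γ y ≤ u x - c * γ x) (v : Tan m x) :
    mvfderiv 𝓘(ℝ, Model m) u x v = c * mvfderiv 𝓘(ℝ, Model m) γ x v := by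
  have hu' := hu.mdifferentiable (by simp) x
  have hγ' := hγ.mdifferentiable (by simp) x
  have h := mvfderiv_eq_zero_of_isLocalMax (w := fun y ↦ u y - c * γ y) (.of_forall hmax)
    (hu'.sub (mdifferentiableAt_const.mul hγ')) v
  rw [mvfderiv_sub_mul c hu' hγ'] at h
  linarith

end

/-! ### Gradients and Hessians at a touching point. -/

namespace PseudoHermitian

variable {m : ℕ} {M : Type*} [TopologicalSpace M] [ChartedSpace (Model m) M]
  [IsManifold 𝓘(ℝ, Model m) ∞ M] (P : PseudoHermitian m M) {u γ : M → ℝ} {x : M} {c : ℝ}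

lemma norm_smul (c : ℝ) (v : Tan m x) : P.norm (c • v) = |c| * P.norm v := by
  simp only [norm, map_smul, LinearMap.smul_apply, smul_eq_mul]
  rw [← mul_assoc, Real.sqrt_mul (mul_self_nonneg c), Real.sqrt_mul_self_eq_abs]

lemma grad_eq_smul (h : ∀ v, mvfderiv 𝓘(ℝ, Model m) u x v = c * mvfderiv 𝓘(ℝ, Model m) γ x v) :
    P.grad u x = c • P.grad γ x := by
  rw [← sub_eq_zero]
  by_contra hne
  refine (P.webster_pos hne).ne' ?_
  rw [LinearMap.map_sub₂, LinearMap.map_smul₂, webster_grad, webster_grad, h]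
  simp

lemma norm_grad_eq (hc : 0 ≤ c)
    (h : ∀ v, mvfderiv 𝓘(ℝ, Model m) u x v = c * mvfderiv 𝓘(ℝ, Model m) γ x v) :
    P.norm (P.grad u x) = c * P.norm (P.grad γ x) := by
  rw [P.grad_eq_smul h, norm_smul, abs_of_nonneg hc]

lemma norm_gradH_eq (hc : 0 ≤ c)
    (h : ∀ v, mvfderiv 𝓘(ℝ, Model m) u x v = c * mvfderiv 𝓘(ℝ, Model m) γ x v) :
    P.norm (P.gradH u x) = c * P.norm (P.gradH γ x) := by
  rw [gradH, P.grad_eq_smul h, map_smul, norm_smul, abs_of_nonneg hc, gradH]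

lemma hess_neg_right (hu : ContMDiffAt 𝓘(ℝ, Model m) 𝓘(ℝ, ℝ) 2 u x) (v w : Tan m x) :
    P.hess u x v (-w) = -P.hess u x v w := by
  have hw : DiffFieldAt (FiberBundle.extend (Model m) w) x :=
    FiberBundle.mdifferentiableAt_extend _ _ w
  have h := P.hess_eq_hessField hu (Y := FiberBundle.extend (Model m) v)
    (Z := (-1 : ℝ) • FiberBundle.extend (Model m) w) (.smul_const_section hw)
  have h1 := P.tanakaWebster.isCovariantDerivativeOn.smul_const (s := univ) (-1 : ℝ) hw
  have h2 : (fun y ↦ mvfderiv 𝓘(ℝ, Model m) u y (((-1 : ℝ) • FiberBundle.extend (Model m) w) y))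
      = -fun y ↦ mvfderiv 𝓘(ℝ, Model m) u y (FiberBundle.extend (Model m) w y) := by
    ext y
    simp
  rw [hessField, h1, h2, mvfderiv_neg] at h
  simp only [Pi.smul_apply, FiberBundle.extend_apply_self, neg_smul, one_smul] at h
  rw [h, hess, hessField]
  simp
  ring

/-- Taking the real part discards the mixed terms, so no symmetry of the Hessian is needed. -/
lemma reHess_eq (hu : ContMDiffAt 𝓘(ℝ, Model m) 𝓘(ℝ, ℝ) 2 u x) (Z : CTan m x) :
    P.reHess u x Z = P.hess u x Z.1 Z.1 + P.hess u x Z.2 Z.2 := by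
  simp [reHess, extendC, conjC, P.hess_neg_right hu]

section Touching

variable (hu : ContMDiff 𝓘(ℝ, Model m) 𝓘(ℝ, ℝ) 2 u) (hγ : ContMDiff 𝓘(ℝ, Model m) 𝓘(ℝ, ℝ) 2 γ)
  (hmax : ∀ y, u y - c * γ y ≤ u x - c * γ x)

-- Differentiate `u - c γ` twice along one extension of `v`. The first-order terms coming from the
-- connection match because `du = c dγ` at `x`, so the comparison holds whatever the connection is.
include hu hγ hmax in
lemma hess_le_of_touching (v : Tan m x) : P.hess u x v v ≤ c * P.hess γ x v v := by
  have hu' := hu.mdifferentiable (by simp)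
  have hγ' := hγ.mdifferentiable (by simp)
  have hv : SmoothFieldAt (FiberBundle.extend (Model m) v) x :=
    FiberBundle.contMDiffAt_extend _ _ v
  have hv' : DiffFieldAt (FiberBundle.extend (Model m) v) x := hv.mdifferentiableAt (by simp)
  have h := mvfderiv_mvfderiv_nonpos_of_isLocalMax (w := fun y ↦ u y - c * γ y)
    (.of_forall hmax) ((hu x).sub (contMDiffAt_const.mul (hγ x))) hv
  simp only [mvfderiv_sub_mul c (hu' _) (hγ' _)] at h
  rw [mvfderiv_sub_mul c (mdifferentiableAt_mvfderiv_apply (hu x) hv')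
    (mdifferentiableAt_mvfderiv_apply (hγ x) hv')] at h
  simp only [hess, hessField]
  rw [mvfderiv_eq_of_touching hu hγ hmax]
  linarith

include hu hγ hmax in
lemma subLaplacian_le_of_touching : P.subLaplacian u x ≤ c * P.subLaplacian γ x := by
  rw [subLaplacian, subLaplacian, Finset.mul_sum]
  exact Finset.sum_le_sum fun i _ ↦ P.hess_le_of_touching hu hγ hmax _

include hu hγ hmax in
lemma reHess_le_of_touching (Z : CTan m x) : P.reHess u x Z ≤ c * P.reHess γ x Z := by
  rw [P.reHess_eq (hu x), P.reHess_eq (hγ x), mul_add]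
  exact add_le_add (P.hess_le_of_touching hu hγ hmax _) (P.hess_le_of_touching hu hγ hmax _)

end Touching

end PseudoHermitian

end CR

/-! ### Passage to the limit. -/

lemma tendsto_const_div_add_one_zero (D : ℝ) :
    Tendsto (fun k : ℕ ↦ D / (k + 1)) atTop (𝓝 0) :=
  tendsto_const_nhds.div_atTop (tendsto_natCast_atTop_atTop.atTop_add tendsto_const_nhds)

lemma tendsto_zero_of_le_mul {n a c s : ℕ → ℝ} {A D : ℝ} (hA : 0 ≤ A) (hn : ∀ k, 0 ≤ n k)
    (hna : ∀ k, n k = c k * a k) (hc : ∀ k, 0 ≤ c k)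
    (h : ∀ᶠ k : ℕ in atTop, (c k = 0 ∨ a k ≤ A * s k) ∧ c k * s k ≤ D / (k + 1)) :
    Tendsto n atTop (𝓝 0) := by
  refine squeeze_zero' (.of_forall hn) ?_
    (by simpa using (tendsto_const_div_add_one_zero D).const_mul A)
  filter_upwards [h] with k ⟨hk, hD⟩
  have h2 := mul_le_mul_of_nonneg_left hD hA
  rcases hk with hk | hk
  · simpa [hna, hk] using h2
  · have h3 := mul_le_mul_of_nonneg_left hk (hc k)
    rw [hna]
    linarith

/-- The limsup is taken in `EReal` because `n` may be unbounded below, where a real limsup could be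
a default value. -/
lemma limsup_nonpos_of_le_mul {n a c s : ℕ → ℝ} {B D : ℝ} (hB : 0 ≤ B)
    (hna : ∀ k, n k ≤ c k * a k) (hc : ∀ k, 0 ≤ c k)
    (h : ∀ᶠ k : ℕ in atTop, (c k = 0 ∨ a k ≤ B * s k) ∧ c k * s k ≤ D / (k + 1)) :
    limsup (fun k ↦ (n k : EReal)) atTop ≤ 0 := by
  have hlim : Tendsto (fun k : ℕ ↦ ((B * (D / (k + 1)) : ℝ) : EReal)) atTop (𝓝 0) := by
    have := (tendsto_const_div_add_one_zero D).const_mul B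
    rw [mul_zero] at this
    exact (continuous_coe_real_ereal.tendsto 0).comp this
  rw [← hlim.limsup_eq]
  refine limsup_le_limsup ?_
  filter_upwards [h] with k ⟨hk, hD⟩
  rw [EReal.coe_le_coe_iff]
  refine (hna k).trans ?_
  rcases hk with hk | hk
  -- When `c k = 0`, the bound `hD` itself supplies `0 ≤ D / (k + 1)`.
  · have h2 := mul_le_mul_of_nonneg_left hD hB
    simp only [hk, zero_mul, mul_zero] at h2 ⊢
    exact h2
  · have h2 := mul_le_mul_of_nonneg_left hD hB
    have h3 := mul_le_mul_of_nonneg_left hk (hc k)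
    linarith

/-! ### The four versions of the maximum principle. -/

theorem theorem3p1 {m : ℕ} {M : Type*} [TopologicalSpace M] [T2Space M]
    [SecondCountableTopology M] [Nonempty M] [ChartedSpace (CR.Model m) M]
    [IsManifold 𝓘(ℝ, CR.Model m) ∞ M] (P : CR.PseudoHermitian m M)
    (γ : M → ℝ) (hγ : ContMDiff 𝓘(ℝ, CR.Model m) 𝓘(ℝ, ℝ) 2 γ) (hγ_nonneg : ∀ x, 0 ≤ γ x)
    (hγ_proper : ∀ η : ℝ, 0 < η → ∃ K : Set M, IsCompact K ∧ ∀ x ∉ K, η < γ x)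
    (A B : ℝ) (hA : 0 < A) (hB : 0 < B)
    (G : ℝ → ℝ) (hG : ContDiffOn ℝ ∞ G (Ici 0)) (hG_zero : 0 < G 0)
    (hG_deriv : ∀ t ∈ Ici (0 : ℝ), 0 ≤ derivWithin G (Ici 0) t)
    (hG_int : ¬ IntegrableAtFilter (fun t : ℝ ↦ G t ^ (-(1 / 2) : ℝ)) atTop volume)
    (hG_lim : limsup (fun t : ℝ ↦ ((t * G (√t) / G t : ℝ) : EReal)) atTop < ⊤) :
    -- the basic statement
    ((∃ K : Set M, IsCompact K ∧ ∀ x ∉ K, P.norm (P.gradH γ x) ≤ A * √(γ x)) →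
      (∃ K : Set M, IsCompact K ∧ ∀ x ∉ K,
        P.subLaplacian γ x ≤ B * √(γ x) * √(G (√(γ x)))) →
      ∀ u : M → ℝ, ContMDiff 𝓘(ℝ, CR.Model m) 𝓘(ℝ, ℝ) 2 u → BddAbove (range u) →
        ∃ x : ℕ → M, Tendsto (fun k ↦ u (x k)) atTop (𝓝 (⨆ y, u y)) ∧
          Tendsto (fun k ↦ P.norm (P.gradH u (x k))) atTop (𝓝 0) ∧
          limsup (fun k ↦ (P.subLaplacian u (x k) : EReal)) atTop ≤ 0) ∧
    -- the stronger hypothesis on the gradient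
    ((∃ K : Set M, IsCompact K ∧ ∀ x ∉ K, P.norm (P.grad γ x) ≤ A * √(γ x)) →
      (∃ K : Set M, IsCompact K ∧ ∀ x ∉ K,
        P.subLaplacian γ x ≤ B * √(γ x) * √(G (√(γ x)))) →
      ∀ u : M → ℝ, ContMDiff 𝓘(ℝ, CR.Model m) 𝓘(ℝ, ℝ) 2 u → BddAbove (range u) →
        ∃ x : ℕ → M, Tendsto (fun k ↦ u (x k)) atTop (𝓝 (⨆ y, u y)) ∧
          Tendsto (fun k ↦ P.norm (P.grad u (x k))) atTop (𝓝 0) ∧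
          limsup (fun k ↦ (P.subLaplacian u (x k) : EReal)) atTop ≤ 0) ∧
    -- the stronger hypothesis on the Hessian
    ((∃ K : Set M, IsCompact K ∧ ∀ x ∉ K, P.norm (P.gradH γ x) ≤ A * √(γ x)) →
      (∃ K : Set M, IsCompact K ∧ ∀ x ∉ K, ∀ X ∈ P.T10 x,
        P.reHess γ x X ≤ B * √(γ x) * √(G (√(γ x))) * P.normC X ^ 2) →
      ∀ u : M → ℝ, ContMDiff 𝓘(ℝ, CR.Model m) 𝓘(ℝ, ℝ) 2 u → BddAbove (range u) →
        ∃ x : ℕ → M, Tendsto (fun k ↦ u (x k)) atTop (𝓝 (⨆ y, u y)) ∧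
          Tendsto (fun k ↦ P.norm (P.gradH u (x k))) atTop (𝓝 0) ∧
          ∀ Y : (k : ℕ) → CR.CTan m (x k), (∀ k, Y k ∈ P.T10 (x k)) → (∀ k, P.normC (Y k) = 1) →
            limsup (fun k ↦ (P.reHess u (x k) (Y k) : EReal)) atTop ≤ 0) ∧
    -- both stronger hypotheses
    ((∃ K : Set M, IsCompact K ∧ ∀ x ∉ K, P.norm (P.grad γ x) ≤ A * √(γ x)) →
      (∃ K : Set M, IsCompact K ∧ ∀ x ∉ K, ∀ X ∈ P.T10 x,
        P.reHess γ x X ≤ B * √(γ x) * √(G (√(γ x))) * P.normC X ^ 2) →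
      ∀ u : M → ℝ, ContMDiff 𝓘(ℝ, CR.Model m) 𝓘(ℝ, ℝ) 2 u → BddAbove (range u) →
        ∃ x : ℕ → M, Tendsto (fun k ↦ u (x k)) atTop (𝓝 (⨆ y, u y)) ∧
          Tendsto (fun k ↦ P.norm (P.grad u (x k))) atTop (𝓝 0) ∧
          ∀ Y : (k : ℕ) → CR.CTan m (x k), (∀ k, Y k ∈ P.T10 (x k)) → (∀ k, P.normC (Y k) = 1) →
            limsup (fun k ↦ (P.reHess u (x k) (Y k) : EReal)) atTop ≤ 0) := by
  have hmono : MonotoneOn G (Ici 0) :=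
    monotoneOn_of_deriv_nonneg (convex_Ici 0) hG.continuousOn
      ((hG.differentiableOn (by simp)).mono interior_subset) fun t ht ↦ by
        rw [← derivWithin_of_mem_nhds (mem_interior_iff_mem_nhds.1 ht)]
        exact hG_deriv t (interior_subset ht)
  -- Here `p` stands for either gradient hypothesis and `q` for either second-order one, so a single
  -- sequence serves all four cases.
  have seq (p q : M → Prop) (hp : ∃ K : Set M, IsCompact K ∧ ∀ x ∉ K, p x)
      (hq : ∃ K : Set M, IsCompact K ∧ ∀ x ∉ K, q x) {u : M → ℝ}
      (hu : ContMDiff 𝓘(ℝ, CR.Model m) 𝓘(ℝ, ℝ) 2 u) (hbdd : BddAbove (range u)) :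
      ∃ (x : ℕ → M) (c : ℕ → ℝ) (D : ℝ), Tendsto (fun k ↦ u (x k)) atTop (𝓝 (⨆ y, u y)) ∧
        (∀ k, 0 ≤ c k) ∧ (∀ k y, u y - c k * γ y ≤ u (x k) - c k * γ (x k)) ∧
        (∀ᶠ k : ℕ in atTop, (c k = 0 ∨ p (x k)) ∧ c k * √(γ (x k)) ≤ D / (k + 1)) ∧
        ∀ᶠ k : ℕ in atTop, (c k = 0 ∨ q (x k)) ∧
          c k * (√(γ (x k)) * √(G (√(γ (x k))))) ≤ D / (k + 1) := by
    obtain ⟨K₁, hK₁, hpK⟩ := hp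
    obtain ⟨K₂, hK₂, hqK⟩ := hq
    obtain ⟨x, c, D, hx, hc, hmax, hev⟩ := exists_seq_isMaxOn_sub_mul hG.continuousOn hmono
      hG_zero hγ.continuous hγ_nonneg hγ_proper hG_int hG_lim hu.continuous hbdd
      (p := fun x ↦ p x ∧ q x) ⟨K₁ ∪ K₂, hK₁.union hK₂, fun x hx ↦ by
        rw [mem_union, not_or] at hx
        exact ⟨hpK x hx.1, hqK x hx.2⟩⟩
    exact ⟨x, c, D, hx, hc, hmax, hev.mono fun k hk ↦ ⟨hk.1.imp_right And.left, hk.2.2⟩,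
      hev.mono fun k hk ↦ ⟨hk.1.imp_right And.right, hk.2.1⟩⟩
  have hessian {u : M → ℝ} (hu : ContMDiff 𝓘(ℝ, CR.Model m) 𝓘(ℝ, ℝ) 2 u) {x : ℕ → M}
      {c : ℕ → ℝ} {D : ℝ} (hc : ∀ k, 0 ≤ c k)
      (hmax : ∀ k y, u y - c k * γ y ≤ u (x k) - c k * γ (x k))
      (hev : ∀ᶠ k : ℕ in atTop, (c k = 0 ∨ ∀ X ∈ P.T10 (x k),
        P.reHess γ (x k) X ≤ B * √(γ (x k)) * √(G (√(γ (x k)))) * P.normC X ^ 2) ∧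
          c k * (√(γ (x k)) * √(G (√(γ (x k))))) ≤ D / (k + 1))
      (Y : (k : ℕ) → CR.CTan m (x k)) (hY : ∀ k, Y k ∈ P.T10 (x k))
      (hY1 : ∀ k, P.normC (Y k) = 1) :
      limsup (fun k ↦ (P.reHess u (x k) (Y k) : EReal)) atTop ≤ 0 := by
    refine limsup_nonpos_of_le_mul hB.le
      (fun k ↦ P.reHess_le_of_touching hu hγ (hmax k) (Y k)) hc (hev.mono fun k hk ↦ ⟨?_, hk.2⟩)
    refine hk.1.imp_right fun h ↦ ?_
    have := h (Y k) (hY k)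
    rwa [hY1, one_pow, mul_one, mul_assoc] at this
  refine ⟨fun h1 h2 u hu hbdd ↦ ?_, fun h1 h2 u hu hbdd ↦ ?_, fun h1 h2 u hu hbdd ↦ ?_,
    fun h1 h2 u hu hbdd ↦ ?_⟩ <;>
  obtain ⟨x, c, D, hx, hc, hmax, hev₁, hev₂⟩ := seq _ _ h1 h2 hu hbdd
  · refine ⟨x, hx, tendsto_zero_of_le_mul hA.le (fun k ↦ Real.sqrt_nonneg _)
      (fun k ↦ P.norm_gradH_eq (hc k) (CR.mvfderiv_eq_of_touching hu hγ (hmax k))) hc hev₁,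
      limsup_nonpos_of_le_mul hB.le (fun k ↦ P.subLaplacian_le_of_touching hu hγ (hmax k)) hc
        (by simpa only [mul_assoc] using hev₂)⟩
  · refine ⟨x, hx, tendsto_zero_of_le_mul hA.le (fun k ↦ Real.sqrt_nonneg _)
      (fun k ↦ P.norm_grad_eq (hc k) (CR.mvfderiv_eq_of_touching hu hγ (hmax k))) hc hev₁,
      limsup_nonpos_of_le_mul hB.le (fun k ↦ P.subLaplacian_le_of_touching hu hγ (hmax k)) hc
        (by simpa only [mul_assoc] using hev₂)⟩
  · exact ⟨x, hx, tendsto_zero_of_le_mul hA.le (fun k ↦ Real.sqrt_nonneg _)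
      (fun k ↦ P.norm_gradH_eq (hc k) (CR.mvfderiv_eq_of_touching hu hγ (hmax k))) hc hev₁,
      hessian hu hc hmax hev₂⟩
  · exact ⟨x, hx, tendsto_zero_of_le_mul hA.le (fun k ↦ Real.sqrt_nonneg _)
      (fun k ↦ P.norm_grad_eq (hc k) (CR.mvfderiv_eq_of_touching hu hγ (hmax k))) hc hev₁,
      hessian hu hc hmax hev₂⟩
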